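/- For every $\delta>0$ there exists $c=c(\delta)>0$ such that the following holds. Let $\alpha\in[0,\pi/2-\delta)$, and let $\mathcal{A}$ and $\mathcal{B}$ be two finite sets of lines through the origin in a real inner product space (of arbitrary dimension) such that the angle between $\ell_1$ and $\ell_2$ is $\alpha$ for every $(\ell_1,\ell_2)\in\mathcal{A}\times\mathcal{B}$; here the angle between two lines is the one in $[0,\pi/2]$. Then, given any choice of a (nonzero) direction vector $v_\ell$ of $\ell$ for every $\ell\in\mathcal{A}\cup\mathcal{B}$, there exist $\mathcal{A}'\subseteq\mathcal{A}$ and $\mathcal{B}'\subseteq\mathcal{B}$ such that $|\mathcal{A}'|\ge c|\mathcal{A}|$, $|\mathcal{B}'|\ge c|\mathcal{B}|$, and either the angle between $v_{\ell_1}$ and $v_{\ell_2}$ is $\alpha$ for every $(\ell_1,\ell_2)\in\mathcal{A}'\times\mathcal{B}'$, or it is $\pi-\alpha$ for every $(\ell_1,\ell_2)\in\mathcal{A}'\times\mathcal{B}'$. -/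

import Mathlib

open scoped LinearAlgebra.Projectivization

/-- `v` is a direction vector of the line `ℓ` through the origin: a nonzero vector spanning `ℓ`. -/
def IsDirectionVector {V : Type*} [AddCommGroup V] [Module ℝ V] (ℓ : ℙ ℝ V) (v : V) : Prop :=
  ∃ hv : v ≠ 0, Projectivization.mk ℝ v hv = ℓ

/-- The angle, in `[0, π / 2]`, between two lines through the origin: the smaller of the two angles
`θ` and `π - θ` formed by direction vectors. It does not depend on these vectors, see
`lineAngle_eq`. -/
noncomputable def lineAngle {V : Type*} [NormedAddCommGroup V] [InnerProductSpace ℝ V]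
    (ℓ₁ ℓ₂ : ℙ ℝ V) : ℝ :=
  min (InnerProductGeometry.angle ℓ₁.rep ℓ₂.rep)
    (Real.pi - InnerProductGeometry.angle ℓ₁.rep ℓ₂.rep)

theorem lineAngle_eq {V : Type*} [NormedAddCommGroup V] [InnerProductSpace ℝ V]
    (ℓ₁ ℓ₂ : ℙ ℝ V) (v₁ v₂ : V) (h₁ : IsDirectionVector ℓ₁ v₁) (h₂ : IsDirectionVector ℓ₂ v₂) :
    lineAngle ℓ₁ ℓ₂ = min (InnerProductGeometry.angle v₁ v₂)
      (Real.pi - InnerProductGeometry.angle v₁ v₂) := by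
  obtain ⟨hv₁, rfl⟩ := h₁
  obtain ⟨hv₂, rfl⟩ := h₂
  obtain ⟨a, ha⟩ := Projectivization.exists_smul_eq_mk_rep ℝ v₁ hv₁
  obtain ⟨b, hb⟩ := Projectivization.exists_smul_eq_mk_rep ℝ v₂ hv₂
  unfold lineAngle
  rw [← ha, ← hb]
  simp only [Units.smul_def]
  rcases lt_or_gt_of_ne a.ne_zero with h | h <;> rcases lt_or_gt_of_ne b.ne_zero with h' | h' <;>
    simp [h, h', InnerProductGeometry.angle_neg_left, InnerProductGeometry.angle_neg_right,
      min_comm]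

/-!
Choose unit direction vectors `u i` for the lines of `A` and `w j` for those of `B`. The matrix
`⟪u i, w j⟫` has entries `g` and `-g`, where `g = cos α` is at least `sin δ`, and the claim is that
such a matrix is constant on a rectangle of linear size (`exists_constant_rectangle`). This has two
parts.

*Reduction to a sparse matrix.* A set of columns on which all sign patterns occur has at most
`1 / g ^ 2` elements, since some signed sum of `n` vectors of the unit ball has norm at most `√n`
(`card_le_of_forall_sign_pattern`). So the sign matrix has bounded VC dimension, and by the
Sauer–Shelah lemma a linear number of rows differ from a common row `i₀` in few columns only
(`exists_cluster`). In the columns where row `i₀` has a given sign `σ`, the vectors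
`x i = (σ / (2 * g)) • (u i₀ - u i)` satisfy `⟪x i, w j⟫ ∈ {0, 1}`, with few ones, and have bounded
norm. It remains to find a zero rectangle of linear size.

*Zero rectangles in sparse matrices* (`IsSparseBoolean.hasZeroRectangle`). If many rows have a one
in a common column, then the mean of the corresponding vectors is not small, so one of them, the
pivot `x p`, has a large inner product with a positive proportion of the others. Replacing these
`x i` by `x i - λ • x p` lowers their norm by a fixed amount, and changes no entry outside the
columns where row `p` has a one. To do this for a positive proportion of all rows, blocks of rows
are captured greedily, each time at the row or column of largest relative degree: then the
proportion of columns lost to the pivot is at most a constant times the proportion of rows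
captured, whatever the density of the matrix is. The greedy process ends with no ones left, or
with a positive proportion of the rows, or of the columns, captured. In the latter cases one passes
to the captured part; as the squared norms decrease by a fixed amount each time, this happens a
bounded number of times.
-/

open Finset
open scoped RealInnerProductSpace

/-! ### Bounded packing numbers from bounded VC dimension -/

/-- Signs can be chosen greedily so that a signed sum of `#s` vectors in the unit ball has norm at
most `√#s`; here `t` is the set of vectors with a plus sign. -/
theorem exists_norm_signed_sum_sq_le {V κ : Type*} [NormedAddCommGroup V] [InnerProductSpace ℝ V]
    [DecidableEq κ] (w : κ → V) (s : Finset κ) (hw : ∀ j ∈ s, ‖w j‖ ≤ 1) :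
    ∃ t ⊆ s, ‖∑ j ∈ t, w j - ∑ j ∈ s \ t, w j‖ ^ 2 ≤ #s := by
  induction s using Finset.induction_on with
  | empty => exact ⟨∅, by simp⟩
  | insert a s ha ih =>
    obtain ⟨t, hts, ht⟩ := ih fun j hj => hw j (mem_insert_of_mem hj)
    have hat : a ∉ t := fun h => ha (hts h)
    have hwa : ‖w a‖ ^ 2 ≤ 1 := pow_le_one₀ (norm_nonneg _) (hw a (mem_insert_self a s))
    rw [card_insert_of_notMem ha]
    push_cast
    set z := ∑ j ∈ t, w j - ∑ j ∈ s \ t, w j with hz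
    rcases le_total 0 ⟪z, w a⟫ with h | h
    · refine ⟨t, hts.trans (subset_insert _ _), ?_⟩
      have : insert a s \ t = insert a (s \ t) := insert_sdiff_of_notMem _ hat
      rw [this, sum_insert (by simp [ha]), show ∑ j ∈ t, w j - (w a + ∑ j ∈ s \ t, w j) = z - w a by
        rw [hz]; abel, norm_sub_sq_real]
      linarith
    · refine ⟨insert a t, insert_subset_insert _ hts, ?_⟩
      have : insert a s \ insert a t = s \ t := by
        ext j; simp only [mem_sdiff, mem_insert]; grind
      rw [this, sum_insert hat, show w a + ∑ j ∈ t, w j - ∑ j ∈ s \ t, w j = z + w a by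
        rw [hz]; abel, norm_add_sq_real]
      linarith

/-- If every sign pattern on `s` is realised with margin `g` by a vector of the unit ball, then
`#s ≤ 1 / g ^ 2`: the bound on the VC dimension of half-spaces with a margin. -/
theorem card_le_of_forall_sign_pattern {V κ : Type*} [NormedAddCommGroup V]
    [InnerProductSpace ℝ V] [DecidableEq κ] (w : κ → V) (s : Finset κ) (hw : ∀ j ∈ s, ‖w j‖ ≤ 1)
    {g : ℝ} (hg : 0 < g)
    (h : ∀ t ⊆ s, ∃ u : V, ‖u‖ ≤ 1 ∧ (∀ j ∈ t, ⟪u, w j⟫ = g) ∧ ∀ j ∈ s \ t, ⟪u, w j⟫ = -g) :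
    (#s : ℝ) ≤ 1 / g ^ 2 := by
  obtain ⟨t, hts, ht⟩ := exists_norm_signed_sum_sq_le w s hw
  obtain ⟨u, hu, hut, hus⟩ := h t hts
  set z := ∑ j ∈ t, w j - ∑ j ∈ s \ t, w j with hz
  have hcard : (#(s \ t) : ℝ) + #t = #s := by exact_mod_cast card_sdiff_add_card_eq_card hts
  have huz : ⟪u, z⟫ = #s * g := by
    rw [hz, inner_sub_right, inner_sum, inner_sum, sum_congr rfl hut, sum_congr rfl hus]
    simp only [sum_const, nsmul_eq_mul]
    rw [← hcard]; ring
  have h1 : #s * g ≤ ‖z‖ := by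
    rw [← huz]
    exact (real_inner_le_norm u z).trans (mul_le_of_le_one_left (norm_nonneg _) hu)
  have h2 : (#s * g) ^ 2 ≤ #s := (pow_le_pow_left₀ (by positivity) h1 2).trans ht
  rw [le_div_iff₀ (by positivity)]
  rcases (Nat.cast_nonneg (α := ℝ) (#s)).eq_or_lt with h0 | h0
  · rw [← h0]; simp
  · nlinarith

/-- If distinct rows of `R` differ in at least a fraction `ε` of the columns `B`, then `k` columns
can be chosen that separate all but a fraction `(1 - ε) ^ k` of the pairs of rows. -/
theorem exists_separating_columns {ι κ : Type*} [DecidableEq ι] [DecidableEq κ]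
    (S : ι → κ → Prop) [∀ i j, Decidable (S i j)] (R : Finset ι) (B : Finset κ)
    (hB : B.Nonempty) {ε : ℝ} (hε : ε ≤ 1)
    (hfar : ∀ i ∈ R, ∀ i' ∈ R, i ≠ i' → ε * #B ≤ #{j ∈ B | ¬(S i j ↔ S i' j)}) (k : ℕ) :
    ∃ T ⊆ B, #T ≤ k ∧
      (#{p ∈ R.offDiag | ∀ j ∈ T, (S p.1 j ↔ S p.2 j)} : ℝ) ≤ (1 - ε) ^ k * #R ^ 2 := by
  induction k with
  | zero =>
    refine ⟨∅, by simp, by simp, ?_⟩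
    have : #R.offDiag ≤ #R ^ 2 := by rw [offDiag_card, sq]; exact Nat.sub_le _ _
    simpa using (by exact_mod_cast this : (#R.offDiag : ℝ) ≤ (#R : ℝ) ^ 2)
  | succ k ih =>
    obtain ⟨T, hTB, hTk, hT⟩ := ih
    set U := {p ∈ R.offDiag | ∀ j ∈ T, (S p.1 j ↔ S p.2 j)} with hU
    -- A column that separates at least the average number of the remaining pairs.
    obtain ⟨j, hj, hjU⟩ : ∃ j ∈ B, ε * #U ≤ (#{p ∈ U | ¬(S p.1 j ↔ S p.2 j)} : ℝ) := by
      by_contra hcon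
      have h1 := sum_lt_sum_of_nonempty hB fun j hj => not_le.1 fun h => hcon ⟨j, hj, h⟩
      have h2 : ∑ j ∈ B, (#{p ∈ U | ¬(S p.1 j ↔ S p.2 j)} : ℝ) =
          ∑ p ∈ U, (#{j ∈ B | ¬(S p.1 j ↔ S p.2 j)} : ℝ) := by
        exact_mod_cast (sum_card_bipartiteAbove_eq_sum_card_bipartiteBelow
          (fun (j : κ) (p : ι × ι) => ¬(S p.1 j ↔ S p.2 j)) (s := B) (t := U))
      have h3 : ∑ p ∈ U, ε * (#B : ℝ) ≤ ∑ p ∈ U, (#{j ∈ B | ¬(S p.1 j ↔ S p.2 j)} : ℝ) := by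
        refine sum_le_sum fun p hp => ?_
        obtain ⟨h4, h5, h6⟩ := mem_offDiag.1 (mem_filter.1 hp).1
        exact hfar _ h4 _ h5 h6
      simp only [sum_const, nsmul_eq_mul] at h1 h3
      nlinarith
    refine ⟨insert j T, insert_subset hj hTB, (card_insert_le _ _).trans (by omega), ?_⟩
    have hsub : {p ∈ R.offDiag | ∀ j' ∈ insert j T, (S p.1 j' ↔ S p.2 j')} ⊆
        {p ∈ U | (S p.1 j ↔ S p.2 j)} := by
      intro p
      simp only [hU, mem_filter, mem_insert, forall_eq_or_imp]
      tauto
    have h1 : (#{p ∈ U | (S p.1 j ↔ S p.2 j)} : ℝ) + #{p ∈ U | ¬(S p.1 j ↔ S p.2 j)} = #U := by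
      exact_mod_cast card_filter_add_card_filter_not (s := U) (fun p => (S p.1 j ↔ S p.2 j))
    have h2 : (#{p ∈ R.offDiag | ∀ j' ∈ insert j T, (S p.1 j' ↔ S p.2 j')} : ℝ) ≤
        #{p ∈ U | (S p.1 j ↔ S p.2 j)} := by exact_mod_cast card_le_card hsub
    calc _ ≤ (1 - ε) * (#U : ℝ) := by linarith
      _ ≤ (1 - ε) * ((1 - ε) ^ k * #R ^ 2) := by gcongr
      _ = _ := by ring

/-- A weak form of the Sauer–Shelah bound, for a family of subsets of `T`. -/
theorem card_le_of_shatters_card_le {κ : Type*} [DecidableEq κ] (𝒜 : Finset (Finset κ))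
    (T : Finset κ) (h𝒜 : ∀ a ∈ 𝒜, a ⊆ T) (d : ℕ) (hd : ∀ s, 𝒜.Shatters s → #s ≤ d) :
    #𝒜 ≤ (d + 1) * (#T + 1) ^ d := by
  have hsub : 𝒜.shatterer ⊆ (range (d + 1)).biUnion fun i => powersetCard i T := by
    intro s hs
    rw [mem_shatterer] at hs
    obtain ⟨u, hu, hsu⟩ := hs.exists_superset
    exact mem_biUnion.2 ⟨#s, by have := hd s hs; simp; omega,
      mem_powersetCard.2 ⟨hsu.trans (h𝒜 u hu), rfl⟩⟩
  calc #𝒜 ≤ #𝒜.shatterer := card_le_card_shatterer 𝒜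
    _ ≤ ∑ i ∈ range (d + 1), #(powersetCard i T) := (card_le_card hsub).trans card_biUnion_le
    _ ≤ ∑ i ∈ range (d + 1), (#T + 1) ^ d := by
      refine sum_le_sum fun i hi => ?_
      rw [card_powersetCard]
      exact (Nat.choose_le_pow _ _).trans ((Nat.pow_le_pow_left (Nat.le_succ _) _).trans
        (Nat.pow_le_pow_right (by omega) (by simp at hi; omega)))
    _ = _ := by simp

/-- A bound on the packing number in terms of the VC dimension `d`: the number of rows that
pairwise differ in a fraction `ε` of the columns is bounded in terms of `d` and `ε`. -/
theorem exists_packing_bound (d : ℕ) {ε : ℝ} (hε : 0 < ε) (hε1 : ε ≤ 1) :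
    ∃ m : ℕ, ∀ {ι κ : Type*} [DecidableEq ι] [DecidableEq κ]
      (S : ι → κ → Prop) [∀ i j, Decidable (S i j)] (R : Finset ι) (B : Finset κ),
      B.Nonempty →
      (∀ s ⊆ B, (∀ t ⊆ s, ∃ i ∈ R, {j ∈ s | S i j} = t) → #s ≤ d) →
      (∀ i ∈ R, ∀ i' ∈ R, i ≠ i' → ε * #B ≤ #{j ∈ B | ¬(S i j ↔ S i' j)}) → #R ≤ m := by
  -- `m ≈ k ^ d` grows slower than `(1 - ε) ^ (-k / 2)`, so `k` columns separate `m + 1` rows.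
  obtain ⟨k, hk⟩ : ∃ k : ℕ,
      (1 - ε) ^ k * (((d + 1) * (k + 1) ^ d + 1 : ℕ) : ℝ) ^ 2 < 1 := by
    have h1 := tendsto_pow_const_mul_const_pow_of_abs_lt_one (2 * d) (r := 1 - ε)
      (by rw [abs_lt]; constructor <;> linarith)
    have h2 := h1.const_mul (((d : ℝ) + 2) ^ 2 * 2 ^ (2 * d))
    rw [mul_zero] at h2
    obtain ⟨k, hk1, hk2⟩ := ((h2.eventually (gt_mem_nhds one_pos)).and
      (Filter.eventually_ge_atTop 1)).exists
    refine ⟨k, lt_of_le_of_lt ?_ hk1⟩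
    have hk3 : (1 : ℝ) ≤ k := by exact_mod_cast hk2
    have h4 : (((d + 1) * (k + 1) ^ d + 1 : ℕ) : ℝ) ≤ (d + 2) * (2 * k) ^ d := by
      push_cast
      have h5 : ((k : ℝ) + 1) ^ d ≤ (2 * k) ^ d := by gcongr; linarith
      have h6 : (1 : ℝ) ≤ (2 * k) ^ d := one_le_pow₀ (by linarith)
      nlinarith [Nat.cast_nonneg (α := ℝ) d]
    calc _ ≤ (1 - ε) ^ k * ((d + 2) * (2 * (k : ℝ)) ^ d) ^ 2 := by
          have : 0 ≤ (1 - ε) ^ k := pow_nonneg (by linarith) _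
          gcongr
      _ = _ := by ring
  refine ⟨(d + 1) * (k + 1) ^ d, fun {ι κ} _ _ S _ R₀ B hB hvc₀ hfar₀ => ?_⟩
  by_contra! hlt
  obtain ⟨R, hR, hRcard⟩ := exists_subset_card_eq (Nat.succ_le_of_lt hlt)
  obtain ⟨T, hTB, hTk, hT⟩ := exists_separating_columns S R B hB hε1
    (fun i hi i' hi' => hfar₀ i (hR hi) i' (hR hi')) k
  rw [hRcard] at hT
  have hT0 : #{p ∈ R.offDiag | ∀ j ∈ T, (S p.1 j ↔ S p.2 j)} = 0 := by
    have := hT.trans_lt hk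
    exact Nat.lt_one_iff.1 (by exact_mod_cast this)
  have hinj : Set.InjOn (fun i => {j ∈ T | S i j}) R := by
    intro i hi i' hi' h
    by_contra hne
    have : (i, i') ∈ {p ∈ R.offDiag | ∀ j ∈ T, (S p.1 j ↔ S p.2 j)} := by
      refine mem_filter.2 ⟨mem_offDiag.2 ⟨hi, hi', hne⟩, fun j hj => ?_⟩
      have := Finset.ext_iff.1 h j
      simpa [hj] using this
    rw [card_eq_zero.1 hT0] at this
    simp at this
  have hcard := card_le_of_shatters_card_le (R.image fun i => {j ∈ T | S i j}) T
    (by simp [filter_subset]) d (fun s hs => by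
      obtain ⟨u, hu, hsu⟩ := hs.exists_superset
      have hsT : s ⊆ T := by
        obtain ⟨i, -, rfl⟩ := mem_image.1 hu
        exact hsu.trans (filter_subset _ _)
      refine hvc₀ s (hsT.trans hTB) fun t ht => ?_
      obtain ⟨u, hu, hut⟩ := hs ht
      obtain ⟨i, hi, rfl⟩ := mem_image.1 hu
      refine ⟨i, hR hi, ?_⟩
      rw [← hut]
      ext j
      simp only [mem_filter, mem_inter]
      constructor
      · rintro ⟨h1, h2⟩; exact ⟨h1, hsT h1, h2⟩
      · rintro ⟨h1, -, h2⟩; exact ⟨h1, h2⟩)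
  rw [card_image_of_injOn hinj, hRcard] at hcard
  have : (d + 1) * (#T + 1) ^ d ≤ (d + 1) * (k + 1) ^ d := by gcongr
  omega

/-- Bounded VC dimension gives a linear number of rows that are all close to a single one: the
centres of a maximal packing form a net. -/
theorem exists_cluster (d : ℕ) {ε : ℝ} (hε : 0 < ε) (hε1 : ε ≤ 1) :
    ∃ m : ℕ, 0 < m ∧ ∀ {ι κ : Type*} [DecidableEq ι] [DecidableEq κ]
      (S : ι → κ → Prop) [∀ i j, Decidable (S i j)] (A : Finset ι) (B : Finset κ),
      A.Nonempty → B.Nonempty →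
      (∀ s ⊆ B, (∀ t ⊆ s, ∃ i ∈ A, {j ∈ s | S i j} = t) → #s ≤ d) →
      ∃ i₀ ∈ A, ∃ A' ⊆ A, #A ≤ m * #A' ∧
        ∀ i ∈ A', (#{j ∈ B | ¬(S i₀ j ↔ S i j)} : ℝ) ≤ ε * #B := by
  obtain ⟨m, hm⟩ := exists_packing_bound d hε hε1
  refine ⟨m + 1, by omega, fun {ι κ} _ _ S _ A B hA hB hvc => ?_⟩
  obtain ⟨R, hR, hmax⟩ := exists_max_image {R ∈ A.powerset | ∀ i ∈ R, ∀ i' ∈ R, i ≠ i' →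
    ε * (#B : ℝ) < #{j ∈ B | ¬(S i j ↔ S i' j)}} card ⟨∅, by simp⟩
  rw [mem_filter, mem_powerset] at hR
  obtain ⟨hRA, hfar⟩ := hR
  have hRm : #R ≤ m := hm S R B hB
    (fun s hs h => hvc s hs fun t ht => (h t ht).imp fun i hi => ⟨hRA hi.1, hi.2⟩)
    fun i hi i' hi' hne => (hfar i hi i' hi' hne).le
  have hnet : ∀ i ∈ A, ∃ r ∈ R, (#{j ∈ B | ¬(S r j ↔ S i j)} : ℝ) ≤ ε * #B := by
    intro i hi
    by_contra h
    have hcon : ∀ r ∈ R, ε * #B < (#{j ∈ B | ¬(S r j ↔ S i j)} : ℝ) :=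
      fun r hr => not_le.1 fun h' => h ⟨r, hr, h'⟩
    have hiR : i ∉ R := fun h => by
      have := hcon i h
      simp only [not_true_eq_false, filter_false, card_empty, Nat.cast_zero] at this
      exact absurd this (not_lt.2 (by positivity))
    have := hmax (insert i R) (mem_filter.2 ⟨mem_powerset.2 (insert_subset hi hRA), ?_⟩)
    · rw [card_insert_of_notMem hiR] at this; omega
    · intro a ha b hb hab
      rcases mem_insert.1 ha with rfl | ha' <;> rcases mem_insert.1 hb with rfl | hb'
      · exact absurd rfl hab
      · simpa only [iff_comm] using hcon b hb'
      · exact hcon a ha'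
      · exact hfar a ha' b hb' hab
  obtain ⟨r, hr, hcard⟩ : ∃ r ∈ R,
      #A ≤ (m + 1) * #{i ∈ A | (#{j ∈ B | ¬(S r j ↔ S i j)} : ℝ) ≤ ε * #B} := by
    by_contra hcon
    have hRne : R.Nonempty := by
      obtain ⟨i, hi⟩ := hA
      obtain ⟨r, hr, -⟩ := hnet i hi
      exact ⟨r, hr⟩
    have h1 := sum_lt_sum_of_nonempty hRne fun r hr => not_le.1 fun h => hcon ⟨r, hr, h⟩
    have h2 : #A ≤ ∑ r ∈ R, #{i ∈ A | (#{j ∈ B | ¬(S r j ↔ S i j)} : ℝ) ≤ ε * #B} := by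
      refine le_trans (card_le_card fun i hi => ?_) card_biUnion_le
      obtain ⟨r, hr, h⟩ := hnet i hi
      exact mem_biUnion.2 ⟨r, hr, mem_filter.2 ⟨hi, h⟩⟩
    rw [← mul_sum, sum_const, smul_eq_mul] at h1
    have h3 := Nat.mul_le_mul_left (m + 1) h2
    have h4 := Nat.mul_le_mul_right #A hRm
    nlinarith
  exact ⟨r, hRA hr, _, filter_subset _ _, hcard, fun i hi => (mem_filter.1 hi).2⟩

/-! ### Zero rectangles in sparse Boolean matrices -/

open Classical in
/-- The matrix `⟪x i, y j⟫`, for `i ∈ A` and `j ∈ B`, has entries `0` and `1` only, the vectors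
have squared norm at most `K`, the quantity `‖x i‖ ^ 2 + ‖y j‖ ^ 2` is at most `t` times the
decrement `1 / (4 * K ^ 3)`, and rows and columns contain at most a fraction `ε` of ones. -/
structure IsSparseBoolean {V ι κ : Type*} [NormedAddCommGroup V] [InnerProductSpace ℝ V]
    (K : ℝ) (t : ℕ) (ε : ℝ) (A : Finset ι) (B : Finset κ) (x : ι → V) (y : κ → V) : Prop where
  boolean : ∀ i ∈ A, ∀ j ∈ B, ⟪x i, y j⟫ = 0 ∨ ⟪x i, y j⟫ = 1
  left_le : ∀ i ∈ A, ‖x i‖ ^ 2 ≤ K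
  right_le : ∀ j ∈ B, ‖y j‖ ^ 2 ≤ K
  potential_le : ∀ i ∈ A, ∀ j ∈ B, ‖x i‖ ^ 2 + ‖y j‖ ^ 2 ≤ t * (1 / (4 * K ^ 3))
  row_le : ∀ i ∈ A, (#{j ∈ B | ⟪x i, y j⟫ = 1} : ℝ) ≤ ε * #B
  col_le : ∀ j ∈ B, (#{i ∈ A | ⟪y j, x i⟫ = 1} : ℝ) ≤ ε * #A

/-- The matrix `⟪x i, y j⟫` vanishes on a rectangle containing at least a fraction `c` of the rows
and of the columns. -/
def HasZeroRectangle {V ι κ : Type*} [NormedAddCommGroup V] [InnerProductSpace ℝ V]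
    (c : ℝ) (A : Finset ι) (B : Finset κ) (x : ι → V) (y : κ → V) : Prop :=
  ∃ A' ⊆ A, ∃ B' ⊆ B, c * #A ≤ #A' ∧ c * #B ≤ #B' ∧ ∀ i ∈ A', ∀ j ∈ B', ⟪x i, y j⟫ = 0

/-- The vectors `x i`, `i ∈ G`, can be replaced by vectors of smaller norm without changing the
entries in the columns `B₀`, apart from a set `D` of exceptional columns whose proportion (relative
to `b`) is at most `2 * K ^ 2` times the proportion of `G` (relative to `a`). -/
def CanShrink {V ι κ : Type*} [NormedAddCommGroup V] [InnerProductSpace ℝ V]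
    (K a b : ℝ) (G : Finset ι) (B₀ : Finset κ) (x : ι → V) (y : κ → V) : Prop :=
  ∃ (x' : ι → V) (D : Finset κ), #D * a ≤ 2 * K ^ 2 * (#G * b) ∧
    ∀ i ∈ G, ‖x' i‖ ^ 2 + 1 / (4 * K ^ 3) ≤ ‖x i‖ ^ 2 ∧
      ∀ j ∈ B₀, j ∉ D → ⟪x' i, y j⟫ = ⟪x i, y j⟫

section

variable {V ι κ : Type*} [NormedAddCommGroup V] [InnerProductSpace ℝ V]

theorem IsSparseBoolean.symm {K : ℝ} {t : ℕ} {ε : ℝ} {A : Finset ι} {B : Finset κ} {x : ι → V}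
    {y : κ → V} (h : IsSparseBoolean K t ε A B x y) : IsSparseBoolean K t ε B A y x where
  boolean j hj i hi := by simpa only [real_inner_comm] using h.boolean i hi j hj
  left_le := h.right_le
  right_le := h.left_le
  potential_le j hj i hi := by rw [add_comm]; exact h.potential_le i hi j hj
  row_le := h.col_le
  col_le := h.row_le

theorem HasZeroRectangle.symm {c : ℝ} {A : Finset ι} {B : Finset κ} {x : ι → V}
    {y : κ → V} (h : HasZeroRectangle c A B x y) : HasZeroRectangle c B A y x := by
  obtain ⟨A', hA, B', hB, hA', hB', h0⟩ := h
  exact ⟨B', hB, A', hA, hB', hA', fun j hj i hi => by rw [real_inner_comm]; exact h0 i hi j hj⟩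

theorem canShrink_empty {K a b : ℝ} {B₀ : Finset κ} {x : ι → V} {y : κ → V} :
    CanShrink K a b (∅ : Finset ι) B₀ x y :=
  ⟨x, ∅, by simp, by simp⟩

theorem CanShrink.mono {K a b : ℝ} {G : Finset ι} {B₀ B₁ : Finset κ} {x : ι → V} {y : κ → V}
    (h : CanShrink K a b G B₀ x y) (hB : B₁ ⊆ B₀) : CanShrink K a b G B₁ x y := by
  obtain ⟨x', D, hD, hx⟩ := h
  exact ⟨x', D, hD, fun i hi => ⟨(hx i hi).1, fun j hj => (hx i hi).2 j (hB hj)⟩⟩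

open Classical in
/-- Vectors having inner product `1` with a common vector have a large mean, so one of them, the
pivot `p`, has a large inner product with a positive proportion of the others. -/
theorem exists_pivot {K : ℝ} (hK : 1 ≤ K) (X : Finset ι) (x : ι → V) (y : V) (hX : X.Nonempty)
    (hxy : ∀ i ∈ X, ⟪x i, y⟫ = 1) (hx : ∀ i ∈ X, ‖x i‖ ^ 2 ≤ K) (hy : ‖y‖ ^ 2 ≤ K) :
    ∃ p ∈ X, (#X : ℝ) ≤ 2 * K ^ 2 * #{i ∈ X | 1 / (2 * K) ≤ ⟪x i, x p⟫} := by
  have hK0 : 0 < K := by linarith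
  have hX0 : (0 : ℝ) < #X := by exact_mod_cast hX.card_pos
  set z := ∑ i ∈ X, x i with hz
  have h1 : (#X : ℝ) ^ 2 ≤ K * ‖z‖ ^ 2 := by
    have h2 : ⟪z, y⟫ = #X := by
      rw [hz, sum_inner, sum_congr rfl hxy]; simp
    have h3 : (#X : ℝ) ≤ ‖z‖ * ‖y‖ := h2 ▸ real_inner_le_norm z y
    calc (#X : ℝ) ^ 2 ≤ (‖z‖ * ‖y‖) ^ 2 := by gcongr
      _ = ‖y‖ ^ 2 * ‖z‖ ^ 2 := by ring
      _ ≤ _ := by gcongr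
  obtain ⟨p, hp, hpz⟩ : ∃ p ∈ X, (#X : ℝ) / K ≤ ⟪z, x p⟫ := by
    by_contra! hcon
    have h2 := sum_lt_sum_of_nonempty hX hcon
    rw [← inner_sum, ← hz, real_inner_self_eq_norm_sq, sum_const, nsmul_eq_mul] at h2
    have h3 : K * (#X * (#X / K)) = (#X : ℝ) ^ 2 := by field_simp
    have := mul_lt_mul_of_pos_left h2 hK0
    linarith
  refine ⟨p, hp, ?_⟩
  have h2 : ⟪z, x p⟫ ≤ K * #{i ∈ X | 1 / (2 * K) ≤ ⟪x i, x p⟫} + #X * (1 / (2 * K)) := by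
    rw [hz, sum_inner, ← sum_filter_add_sum_filter_not X (fun i => 1 / (2 * K) ≤ ⟪x i, x p⟫)]
    refine add_le_add ?_ ?_
    · rw [mul_comm K, ← nsmul_eq_mul]
      refine sum_le_card_nsmul _ _ _ fun i hi => ?_
      have hi' := hx i (mem_filter.1 hi).1
      have hp' := hx p hp
      have := real_inner_le_norm (x i) (x p)
      nlinarith [sq_nonneg (‖x i‖ - ‖x p‖)]
    · refine (sum_le_card_nsmul _ _ (1 / (2 * K)) fun i hi => ?_).trans ?_
      · exact (not_le.1 (mem_filter.1 hi).2).le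
      · rw [nsmul_eq_mul]
        gcongr
        exact filter_subset _ _
  have h3 : (#X : ℝ) / K ≤ K * #{i ∈ X | 1 / (2 * K) ≤ ⟪x i, x p⟫} + #X * (1 / (2 * K)) :=
    hpz.trans h2
  have h4 := mul_le_mul_of_nonneg_left h3 (by positivity : 0 ≤ 2 * K)
  have h5 : 2 * K * (#X / K) = 2 * (#X : ℝ) := by field_simp
  have h6 : 2 * K * (#X * (1 / (2 * K))) = (#X : ℝ) := by field_simp
  rw [mul_add, h5, h6] at h4
  linarith

open Classical in
/-- A block `X` of rows with a one in a common column, whose degrees are at most the degree of that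
column in proportion, extends a set of rows that can be shrunk: a multiple of the pivot row is
subtracted from the rows having a large inner product with it, at the cost of the columns in which
the pivot row has a one. -/
theorem CanShrink.exists_union {K a b : ℝ} (hK : 1 ≤ K) {G X : Finset ι} {B₀ : Finset κ}
    {x : ι → V} {y : κ → V} (h : CanShrink K a b G B₀ x y) (hb : 0 ≤ b)
    (hGX : Disjoint G X) (hX : X.Nonempty) {j₀ : κ} (hxy : ∀ i ∈ X, ⟪x i, y j₀⟫ = 1)
    (hx : ∀ i ∈ X, ‖x i‖ ^ 2 ≤ K) (hy : ‖y j₀‖ ^ 2 ≤ K)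
    (h01 : ∀ i ∈ X, ∀ j ∈ B₀, ⟪x i, y j⟫ = 0 ∨ ⟪x i, y j⟫ = 1)
    (hdeg : ∀ i ∈ X, #{j ∈ B₀ | ⟪x i, y j⟫ = 1} * a ≤ #X * b) :
    ∃ X' ⊆ X, X'.Nonempty ∧ CanShrink K a b (G ∪ X') B₀ x y := by
  have hK0 : 0 < K := by linarith
  obtain ⟨p, hp, hcard⟩ := exists_pivot hK X x (y j₀) hX hxy hx hy
  obtain ⟨x', D, hD, hx'⟩ := h
  set X' := {i ∈ X | 1 / (2 * K) ≤ ⟪x i, x p⟫} with hX'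
  have hX'X : X' ⊆ X := filter_subset _ _
  have hX'0 : X'.Nonempty := by
    rw [nonempty_iff_ne_empty]
    intro h0
    rw [h0] at hcard
    simp at hcard
    exact hX.ne_empty hcard
  -- With `⟪x i, x p⟫ ≥ 1 / (2 * K)` and `‖x p‖ ^ 2 ≤ K`, the multiple `1 / (2 * K ^ 2)` of `x p`
  -- gives the largest guaranteed decrease of the norm.
  refine ⟨X', hX'X, hX'0,
    fun i => if i ∈ X' then x i - (1 / (2 * K ^ 2)) • x p else x' i,
    D ∪ {j ∈ B₀ | ⟪x p, y j⟫ = 1}, ?_, fun i hi => ?_⟩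
  · have h1 : (#(D ∪ {j ∈ B₀ | ⟪x p, y j⟫ = 1}) : ℝ) ≤ #D + #{j ∈ B₀ | ⟪x p, y j⟫ = 1} := by
      exact_mod_cast card_union_le _ _
    rw [card_union_of_disjoint (disjoint_of_subset_right hX'X hGX)]
    push_cast
    have h2 := hdeg p hp
    have h3 := mul_le_mul_of_nonneg_right hcard hb
    rcases le_total 0 a with ha | ha
    · have h4 := mul_le_mul_of_nonneg_right h1 ha
      linarith
    · have h4 : (#(D ∪ {j ∈ B₀ | ⟪x p, y j⟫ = 1}) : ℝ) * a ≤ 0 :=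
        mul_nonpos_of_nonneg_of_nonpos (by positivity) ha
      have h5 : 0 ≤ 2 * K ^ 2 * ((#G + #X' : ℝ) * b) := by positivity
      linarith
  · by_cases hiX : i ∈ X'
    · simp only [if_pos hiX]
      refine ⟨?_, fun j hj hjD => ?_⟩
      · have h1 : 1 / (2 * K) ≤ ⟪x i, x p⟫ := (mem_filter.1 hiX).2
        rw [norm_sub_sq_real, inner_smul_right, norm_smul, mul_pow, Real.norm_eq_abs, sq_abs]
        have h2 : 1 / (2 * K ^ 2) * (1 / (2 * K)) ≤ 1 / (2 * K ^ 2) * ⟪x i, x p⟫ := by gcongr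
        have h3 : (1 / (2 * K ^ 2)) ^ 2 * ‖x p‖ ^ 2 ≤ (1 / (2 * K ^ 2)) ^ 2 * K := by
          gcongr
          exact hx p hp
        have h4 : 1 / (2 * K ^ 2) * (1 / (2 * K)) = 1 / (4 * K ^ 3) := by field_simp; ring
        have h5 : (1 / (2 * K ^ 2)) ^ 2 * K = 1 / (4 * K ^ 3) := by field_simp; ring
        linarith
      · have h1 : ⟪x p, y j⟫ = 0 := (h01 p hp j hj).resolve_right fun h1 =>
          hjD (mem_union_right _ (mem_filter.2 ⟨hj, h1⟩))
        rw [inner_sub_left, real_inner_smul_left, h1, mul_zero, sub_zero]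
    · simp only [if_neg hiX]
      have hiG : i ∈ G := (mem_union.1 hi).resolve_right hiX
      exact ⟨(hx' i hiG).1, fun j hj hjD =>
        (hx' i hiG).2 j hj fun h => hjD (mem_union_left _ h)⟩

open Classical in
/-- The greedy step, performed at a column whose degree is maximal in proportion. -/
theorem CanShrink.exists_sdiff {K ε : ℝ} {t : ℕ} (hK : 1 ≤ K)
    {A A₀ : Finset ι} {B B₀ : Finset κ} {x : ι → V} {y : κ → V}
    (hs : IsSparseBoolean K t ε A B x y) (hA : A₀ ⊆ A) (hB : B₀ ⊆ B)
    (h : CanShrink K #A #B (A \ A₀) B₀ x y) {j₀ : κ} (hj₀ : j₀ ∈ B₀)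
    (hne : {i ∈ A₀ | ⟪y j₀, x i⟫ = 1}.Nonempty)
    (hdeg : ∀ i ∈ A₀, (#{j ∈ B₀ | ⟪x i, y j⟫ = 1} * #A : ℝ) ≤ #{i ∈ A₀ | ⟪y j₀, x i⟫ = 1} * #B) :
    ∃ A₁ ⊂ A₀, (#(A \ A₁) : ℝ) ≤ #(A \ A₀) + ε * #A ∧ CanShrink K #A #B (A \ A₁) B₀ x y := by
  set X := {i ∈ A₀ | ⟪y j₀, x i⟫ = 1} with hX
  have hXA : X ⊆ A₀ := filter_subset _ _
  obtain ⟨X', hX'X, hX', hc⟩ := h.exists_union hK (by positivity : (0 : ℝ) ≤ #B)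
    (disjoint_of_subset_right hXA sdiff_disjoint) hne (j₀ := j₀)
    (fun i hi => by rw [real_inner_comm]; exact (mem_filter.1 hi).2)
    (fun i hi => hs.left_le i (hA (hXA hi))) (hs.right_le j₀ (hB hj₀))
    (fun i hi j hj => hs.boolean i (hA (hXA hi)) j (hB hj)) fun i hi => hdeg i (hXA hi)
  have hX'A := hX'X.trans hXA
  have hEq : A \ A₀ ∪ X' = A \ (A₀ \ X') := by
    ext i
    have h1 : i ∈ X' → i ∈ A₀ := fun h => hX'A h
    have h2 : i ∈ A₀ → i ∈ A := fun h => hA h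
    simp only [mem_union, mem_sdiff]
    tauto
  rw [hEq] at hc
  refine ⟨A₀ \ X', sdiff_ssubset hX'A hX', ?_, hc⟩
  have h1 : (#(A \ A₀ ∪ X') : ℝ) ≤ #(A \ A₀) + #X' := by exact_mod_cast card_union_le _ _
  have h2 : X' ⊆ {i ∈ A | ⟪y j₀, x i⟫ = 1} := hX'X.trans (filter_subset_filter _ hA)
  have h3 : (#X' : ℝ) ≤ #{i ∈ A | ⟪y j₀, x i⟫ = 1} := by exact_mod_cast card_le_card h2
  rw [← hEq]
  linarith [hs.col_le j₀ (hB hj₀)]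

/-- Greedy blocks are captured until either no ones are left, or a positive proportion of the rows
or of the columns can be shrunk. -/
theorem exists_zero_or_canShrink {K ε η : ℝ} {t : ℕ} (hK : 1 ≤ K) (hη : 0 ≤ η) (hεη : ε ≤ η)
    {A : Finset ι} {B : Finset κ} {x : ι → V} {y : κ → V}
    (hs : IsSparseBoolean K t ε A B x y) :
    HasZeroRectangle (1 - η) A B x y ∨
    (∃ G ⊆ A, ∃ B₀ ⊆ B, η * #A ≤ #G ∧ #G ≤ 2 * η * #A ∧ (1 - η) * #B ≤ #B₀ ∧
      CanShrink K #A #B G B₀ x y) ∨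
    ∃ H ⊆ B, ∃ A₀ ⊆ A, η * #B ≤ #H ∧ #H ≤ 2 * η * #B ∧ (1 - η) * #A ≤ #A₀ ∧
      CanShrink K #B #A H A₀ y x := by
  classical
  -- `A₀` and `B₀` are the rows and columns not captured so far.
  suffices H : ∀ n : ℕ, ∀ A₀ ⊆ A, ∀ B₀ ⊆ B, #A₀ + #B₀ = n →
      (#(A \ A₀) : ℝ) ≤ η * #A → (#(B \ B₀) : ℝ) ≤ η * #B →
      CanShrink K #A #B (A \ A₀) B₀ x y → CanShrink K #B #A (B \ B₀) A₀ y x →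
      HasZeroRectangle (1 - η) A B x y ∨
      (∃ G ⊆ A, ∃ B₀ ⊆ B, η * #A ≤ #G ∧ #G ≤ 2 * η * #A ∧ (1 - η) * #B ≤ #B₀ ∧
        CanShrink K #A #B G B₀ x y) ∨
      ∃ H ⊆ B, ∃ A₀ ⊆ A, η * #B ≤ #H ∧ #H ≤ 2 * η * #B ∧ (1 - η) * #A ≤ #A₀ ∧
        CanShrink K #B #A H A₀ y x by
    refine H _ A Subset.rfl B Subset.rfl rfl ?_ ?_ ?_ ?_
    · rw [Finset.sdiff_self]; simp; positivity
    · rw [Finset.sdiff_self]; simp; positivity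
    · rw [Finset.sdiff_self]; exact canShrink_empty
    · rw [Finset.sdiff_self]; exact canShrink_empty
  intro n
  induction n using Nat.strong_induction_on with
  | _ n ih =>
  intro A₀ hA B₀ hB hn hAη hBη hcA hcB
  have hA₀ : (1 - η) * #A ≤ #A₀ := by
    have : (#(A \ A₀) : ℝ) + #A₀ = #A := by exact_mod_cast card_sdiff_add_card_eq_card hA
    linarith
  have hB₀ : (1 - η) * #B ≤ #B₀ := by
    have : (#(B \ B₀) : ℝ) + #B₀ = #B := by exact_mod_cast card_sdiff_add_card_eq_card hB
    linarith
  by_cases hzero : ∀ i ∈ A₀, ∀ j ∈ B₀, ⟪x i, y j⟫ = 0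
  · exact Or.inl ⟨A₀, hA, B₀, hB, hA₀, hB₀, hzero⟩
  push Not at hzero
  obtain ⟨i₁, hi₁, j₁, hj₁, hij⟩ := hzero
  have hij1 : ⟪x i₁, y j₁⟫ = 1 := (hs.boolean i₁ (hA hi₁) j₁ (hB hj₁)).resolve_left hij
  obtain ⟨i₀, hi₀, hi₀max⟩ := exists_max_image A₀ (fun i => #{j ∈ B₀ | ⟪x i, y j⟫ = 1}) ⟨i₁, hi₁⟩
  obtain ⟨j₀, hj₀, hj₀max⟩ := exists_max_image B₀ (fun j => #{i ∈ A₀ | ⟪y j, x i⟫ = 1}) ⟨j₁, hj₁⟩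
  have hi₀ne : {j ∈ B₀ | ⟪x i₀, y j⟫ = 1}.Nonempty := card_pos.1 <|
    (card_pos.2 ⟨j₁, mem_filter.2 ⟨hj₁, hij1⟩⟩).trans_le (hi₀max i₁ hi₁)
  have hj₀ne : {i ∈ A₀ | ⟪y j₀, x i⟫ = 1}.Nonempty := card_pos.1 <|
    (card_pos.2 ⟨i₁, mem_filter.2 ⟨hi₁, by rw [real_inner_comm]; exact hij1⟩⟩).trans_le
      (hj₀max j₁ hj₁)
  -- Either the row `i₀` or the column `j₀` has the largest degree in proportion.
  rcases le_total (#{j ∈ B₀ | ⟪x i₀, y j⟫ = 1} * #A : ℝ) (#{i ∈ A₀ | ⟪y j₀, x i⟫ = 1} * #B)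
    with hle | hle
  · obtain ⟨A₁, hA₁, hcard, hc⟩ := hcA.exists_sdiff hK hs hA hB hj₀ hj₀ne fun i hi => by
      refine le_trans ?_ hle
      exact mul_le_mul_of_nonneg_right (by exact_mod_cast hi₀max i hi) (by positivity)
    by_cases hbig : η * #A ≤ (#(A \ A₁) : ℝ)
    · refine Or.inr (Or.inl ⟨A \ A₁, sdiff_subset, B₀, hB, hbig, ?_, hB₀, hc⟩)
      have : ε * #A ≤ η * #A := by gcongr
      linarith
    · exact ih (#A₁ + #B₀) (by have := card_lt_card hA₁; omega) A₁ (hA₁.subset.trans hA) B₀ hB rfl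
        (not_le.1 hbig).le hBη hc (hcB.mono hA₁.subset)
  · obtain ⟨B₁, hB₁, hcard, hc⟩ := hcB.exists_sdiff hK hs.symm hB hA hi₀ hi₀ne fun j hj => by
      refine le_trans ?_ hle
      exact mul_le_mul_of_nonneg_right (by exact_mod_cast hj₀max j hj) (by positivity)
    by_cases hbig : η * #B ≤ (#(B \ B₁) : ℝ)
    · refine Or.inr (Or.inr ⟨B \ B₁, sdiff_subset, A₀, hA, hbig, ?_, hA₀, hc⟩)
      have : ε * #B ≤ η * #B := by gcongr
      linarith
    · exact ih (#A₀ + #B₁) (by have := card_lt_card hB₁; omega) A₀ hA B₁ (hB₁.subset.trans hB) rfl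
        hAη (not_le.1 hbig).le (hcA.mono hB₁.subset) hc

/-- Shrinking a positive proportion of the rows lowers the potential by one step, at the cost of
constant factors in the density and in the size of the rectangle. -/
theorem IsSparseBoolean.hasZeroRectangle_of_canShrink {K η : ℝ} {t : ℕ} (hK : 1 ≤ K) (hη : 0 < η)
    (hηK : 16 * K ^ 2 * η ≤ 1) {A G : Finset ι} {B B₀ : Finset κ} {x : ι → V} {y : κ → V}
    (hs : IsSparseBoolean K (t + 1) (η ^ (t + 1)) A B x y) (hA0 : A.Nonempty)
    (hG : G ⊆ A) (hB : B₀ ⊆ B) (hGη : η * #A ≤ #G) (hGη' : #G ≤ 2 * η * #A)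
    (hBη : (1 - η) * #B ≤ #B₀) (hc : CanShrink K #A #B G B₀ x y)
    (ih : ∀ (A : Finset ι) (B : Finset κ) (x : ι → V) (y : κ → V),
      IsSparseBoolean K t (η ^ t) A B x y → HasZeroRectangle (η ^ t) A B x y) :
    HasZeroRectangle (η ^ (t + 1)) A B x y := by
  classical
  have hηt : 0 ≤ η ^ t := by positivity
  have hη16 : 16 * η ≤ 1 := by
    have : 1 * η ≤ K ^ 2 * η := by gcongr; exact one_le_pow₀ hK
    linarith
  have hpos : 0 < 1 / (4 * K ^ 3) := by
    have : 0 < K := by linarith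
    positivity
  obtain ⟨x', D, hD, hx⟩ := hc
  have hD' : (#D : ℝ) ≤ 1 / 4 * #B := by
    have hA0' : (0 : ℝ) < #A := by exact_mod_cast hA0.card_pos
    refine le_of_mul_le_mul_right (hD.trans ?_) hA0'
    calc 2 * K ^ 2 * ((#G : ℝ) * #B) ≤ 2 * K ^ 2 * ((2 * η * #A) * #B) := by gcongr
      _ = 16 * K ^ 2 * η * (1 / 4 * #B * #A) := by ring
      _ ≤ 1 * (1 / 4 * #B * #A) := by gcongr
      _ = _ := by ring
  have hB'B : B₀ \ D ⊆ B := sdiff_subset.trans hB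
  have hB' : (#B : ℝ) / 2 ≤ #(B₀ \ D) := by
    have h1 : (#B₀ : ℝ) ≤ #(B₀ \ D) + #D := by
      have := le_card_sdiff D B₀
      exact_mod_cast (by omega : #B₀ ≤ #(B₀ \ D) + #D)
    nlinarith [Nat.cast_nonneg (α := ℝ) #B]
  have hEq : ∀ i ∈ G, ∀ j ∈ B₀ \ D, ⟪x' i, y j⟫ = ⟪x i, y j⟫ := fun i hi j hj =>
    (hx i hi).2 j (mem_sdiff.1 hj).1 (mem_sdiff.1 hj).2
  have hs' : IsSparseBoolean K t (η ^ t) G (B₀ \ D) x' y := by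
    refine ⟨fun i hi j hj => ?_, fun i hi => ?_, fun j hj => hs.right_le j (hB'B hj),
      fun i hi j hj => ?_, fun i hi => ?_, fun j hj => ?_⟩
    · rw [hEq i hi j hj]
      exact hs.boolean i (hG hi) j (hB'B hj)
    · linarith [(hx i hi).1, hs.left_le i (hG hi)]
    · have h1 := (hx i hi).1
      have h2 := hs.potential_le i (hG hi) j (hB'B hj)
      push_cast at h2
      linarith
    · have h1 : #{j ∈ B₀ \ D | ⟪x' i, y j⟫ = 1} ≤ #{j ∈ B | ⟪x i, y j⟫ = 1} := by
        refine card_le_card fun j hj => ?_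
        rw [mem_filter] at hj ⊢
        exact ⟨hB'B hj.1, hEq i hi j hj.1 ▸ hj.2⟩
      have h2 : (#{j ∈ B₀ \ D | ⟪x' i, y j⟫ = 1} : ℝ) ≤ #{j ∈ B | ⟪x i, y j⟫ = 1} := by
        exact_mod_cast h1
      calc _ ≤ η ^ (t + 1) * #B := h2.trans (hs.row_le i (hG hi))
        _ = η ^ t * (η * #B) := by ring
        _ ≤ η ^ t * #(B₀ \ D) := by
          gcongr
          nlinarith [Nat.cast_nonneg (α := ℝ) #B]
    · have h1 : #{i ∈ G | ⟪y j, x' i⟫ = 1} ≤ #{i ∈ A | ⟪y j, x i⟫ = 1} := by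
        refine card_le_card fun i hi => ?_
        rw [mem_filter, real_inner_comm] at hi ⊢
        exact ⟨hG hi.1, hEq i hi.1 j hj ▸ hi.2⟩
      have h2 : (#{i ∈ G | ⟪y j, x' i⟫ = 1} : ℝ) ≤ #{i ∈ A | ⟪y j, x i⟫ = 1} := by
        exact_mod_cast h1
      calc _ ≤ η ^ (t + 1) * #A := h2.trans (hs.col_le j (hB'B hj))
        _ = η ^ t * (η * #A) := by ring
        _ ≤ η ^ t * #G := by gcongr
  obtain ⟨A', hA', B', hB'', hA'c, hB'c, h0⟩ := ih _ _ _ _ hs'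
  refine ⟨A', hA'.trans hG, B', hB''.trans hB'B, ?_, ?_, fun i hi j hj => ?_⟩
  · calc η ^ (t + 1) * #A = η ^ t * (η * #A) := by ring
      _ ≤ η ^ t * #G := by gcongr
      _ ≤ _ := hA'c
  · calc η ^ (t + 1) * #B = η ^ t * (η * #B) := by ring
      _ ≤ η ^ t * #(B₀ \ D) := by
        gcongr
        nlinarith [Nat.cast_nonneg (α := ℝ) #B]
      _ ≤ _ := hB'c
  · rw [← hEq i (hA' hi) j (hB'' hj)]
    exact h0 i hi j hj

end

/-- A sufficiently sparse Boolean matrix with a bounded factorization has an all-zero rectangle of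
linear size. The potential drops from `t` to `0`, where all vectors vanish. -/
theorem IsSparseBoolean.hasZeroRectangle.{u, v} {V : Type v} [NormedAddCommGroup V]
    [InnerProductSpace ℝ V] {K η : ℝ} (hK : 1 ≤ K) (hη : 0 < η) (hηK : 16 * K ^ 2 * η ≤ 1)
    (t : ℕ) : ∀ {ι κ : Type u} (A : Finset ι) (B : Finset κ) (x : ι → V) (y : κ → V),
      IsSparseBoolean K t (η ^ t) A B x y → HasZeroRectangle (η ^ t) A B x y := by
  have hη16 : 16 * η ≤ 1 := by
    have : 1 * η ≤ K ^ 2 * η := by gcongr; exact one_le_pow₀ hK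
    linarith
  induction t with
  | zero =>
    intro ι κ A B x y hs
    refine ⟨A, Subset.rfl, B, Subset.rfl, by simp, by simp, fun i hi j hj => ?_⟩
    have h1 := hs.potential_le i hi j hj
    have h2 : ‖x i‖ = 0 := by
      simp only [CharP.cast_eq_zero, zero_mul] at h1
      nlinarith [sq_nonneg ‖x i‖, sq_nonneg ‖y j‖]
    rw [norm_eq_zero.1 h2, inner_zero_left]
  | succ t ih =>
    intro ι κ A B x y hs
    have h1 : η ^ (t + 1) ≤ η := by
      rw [pow_succ]
      exact mul_le_of_le_one_left hη.le (pow_le_one₀ hη.le (by linarith))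
    rcases A.eq_empty_or_nonempty with rfl | hA
    · exact ⟨∅, by simp, B, Subset.rfl, by simp,
        mul_le_of_le_one_left (by positivity) (by linarith), by simp⟩
    rcases B.eq_empty_or_nonempty with rfl | hB
    · exact ⟨A, Subset.rfl, ∅, by simp,
        mul_le_of_le_one_left (by positivity) (by linarith), by simp, by simp⟩
    rcases exists_zero_or_canShrink hK hη.le h1 hs with h | h | h
    · obtain ⟨A', hA', B', hB', h2, h3, h0⟩ := h
      refine ⟨A', hA', B', hB', le_trans ?_ h2, le_trans ?_ h3, h0⟩
      · gcongr; linarith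
      · gcongr; linarith
    · obtain ⟨G, hG, B₀, hB₀, h2, h3, h4, hc⟩ := h
      exact hs.hasZeroRectangle_of_canShrink hK hη hηK hA hG hB₀ h2 h3 h4 hc fun A B x y => ih A B x y
    · obtain ⟨G, hG, B₀, hB₀, h2, h3, h4, hc⟩ := h
      exact (hs.symm.hasZeroRectangle_of_canShrink hK hη hηK hB hG hB₀ h2 h3 h4 hc
        fun A B x y => ih A B x y).symm

/-! ### Constant-sign rectangles in matrices of inner products -/

/-- Markov's inequality for the columns of a relation all of whose rows are sparse. -/
theorem card_le_two_mul_card_filter_sparse {ι κ : Type*} (P : ι → κ → Prop)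
    [∀ i j, Decidable (P i j)] (A : Finset ι) (B : Finset κ) {δ : ℝ} (hδ : 0 < δ)
    (hA : A.Nonempty) (h : ∀ i ∈ A, (#{j ∈ B | P i j} : ℝ) ≤ δ * #B) :
    (#B : ℝ) ≤ 2 * #{j ∈ B | (#{i ∈ A | P i j} : ℝ) ≤ 2 * δ * #A} := by
  have hA0 : (0 : ℝ) < #A := by exact_mod_cast hA.card_pos
  set p : κ → Prop := fun j => (#{i ∈ A | P i j} : ℝ) ≤ 2 * δ * #A with hp
  have h1 : (#{j ∈ B | p j} : ℝ) + #{j ∈ B | ¬p j} = #B := by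
    exact_mod_cast card_filter_add_card_filter_not (s := B) p
  have h2 : (#{j ∈ B | ¬p j} : ℝ) * (2 * δ * #A) ≤ #A * (δ * #B) :=
    calc (#{j ∈ B | ¬p j} : ℝ) * (2 * δ * #A)
        ≤ ∑ j ∈ B with ¬p j, (#{i ∈ A | P i j} : ℝ) := by
          rw [← nsmul_eq_mul]
          exact card_nsmul_le_sum _ _ _ fun j hj => (not_le.1 (mem_filter.1 hj).2).le
      _ ≤ ∑ j ∈ B, (#{i ∈ A | P i j} : ℝ) :=
          sum_le_sum_of_subset_of_nonneg (filter_subset _ _) fun _ _ _ => by positivity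
      _ = ∑ i ∈ A, (#{j ∈ B | P i j} : ℝ) := by
          exact_mod_cast (sum_card_bipartiteAbove_eq_sum_card_bipartiteBelow P
            (s := A) (t := B)).symm
      _ ≤ #A * (δ * #B) := by
          rw [← nsmul_eq_mul]
          exact sum_le_card_nsmul _ _ _ h
  have h3 : (2 * (#{j ∈ B | ¬p j} : ℝ)) * (δ * #A) ≤ #B * (δ * #A) := by linarith
  have h4 := le_of_mul_le_mul_right h3 (by positivity)
  linarith

/-- A matrix of inner products of vectors in the unit ball, with entries `g` and `-g` only, is
constant on a rectangle of linear size, with a constant that depends only on a lower bound `γ`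
for `g`. -/
theorem exists_constant_rectangle.{u, v} {γ : ℝ} (hγ : 0 < γ) :
    ∃ c : ℝ, 0 < c ∧ c ≤ 1 ∧
      ∀ {V : Type v} [NormedAddCommGroup V] [InnerProductSpace ℝ V] {ι κ : Type u}
        (A : Finset ι) (B : Finset κ) (u : ι → V) (w : κ → V) (g : ℝ), γ ≤ g →
        A.Nonempty → B.Nonempty → (∀ i ∈ A, ‖u i‖ ≤ 1) → (∀ j ∈ B, ‖w j‖ ≤ 1) →
        (∀ i ∈ A, ∀ j ∈ B, ⟪u i, w j⟫ = g ∨ ⟪u i, w j⟫ = -g) →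
        ∃ A' ⊆ A, ∃ B' ⊆ B, c * #A ≤ #A' ∧ c * #B ≤ #B' ∧
          ((∀ i ∈ A', ∀ j ∈ B', ⟪u i, w j⟫ = g) ∨ ∀ i ∈ A', ∀ j ∈ B', ⟪u i, w j⟫ = -g) := by
  classical
  set K : ℝ := 1 + 1 / γ ^ 2 with hKdef
  have hK : 1 ≤ K := le_add_of_nonneg_right (by positivity)
  have hK0 : 0 < K := by linarith
  set η : ℝ := 1 / (16 * K ^ 2) with hηdef
  have hη : 0 < η := by positivity
  have hηK : 16 * K ^ 2 * η ≤ 1 := by rw [hηdef]; field_simp; exact le_rfl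
  have hη1 : η ≤ 1 := by
    rw [hηdef, div_le_one (by positivity)]
    nlinarith [one_le_pow₀ hK (n := 2)]
  -- The initial potential is at most `2 * K`, and each step lowers it by `1 / (4 * K ^ 3)`.
  set t : ℕ := ⌈8 * K ^ 4⌉₊ with htdef
  have ht : 2 * K ≤ t * (1 / (4 * K ^ 3)) := by
    have h1 : 8 * K ^ 4 ≤ t := Nat.le_ceil _
    calc 2 * K = 8 * K ^ 4 * (1 / (4 * K ^ 3)) := by field_simp; ring
      _ ≤ _ := by gcongr
  have hηt : 0 < η ^ t := by positivity
  have hηt1 : η ^ t ≤ 1 := pow_le_one₀ hη.le hη1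
  obtain ⟨m, hm, hcluster⟩ := exists_cluster ⌊1 / γ ^ 2⌋₊ (ε := η ^ t / 4) (by positivity)
    (by linarith)
  have hm1 : (1 : ℝ) ≤ m := by exact_mod_cast hm
  have hm0 : (0 : ℝ) < m := by linarith
  refine ⟨η ^ t / (4 * m), by positivity, ?_, fun {V} _ _ {ι κ} A B u w g hg hA hB hu hw hpm => ?_⟩
  · rw [div_le_one (by positivity)]; linarith
  have hg0 : 0 < g := hγ.trans_le hg
  have hgne : g ≠ -g := by linarith
  obtain ⟨i₀, hi₀, A₁, hA₁, hA₁card, hclose⟩ := hcluster (fun i j => ⟪u i, w j⟫ = g) A B hA hB (by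
    intro s hs hshat
    refine Nat.le_floor ((card_le_of_forall_sign_pattern w s (fun j hj => hw j (hs hj)) hg0
      fun r hr => ?_).trans (by gcongr))
    obtain ⟨i, hi, hir⟩ := hshat r hr
    refine ⟨u i, hu i hi, fun j hj => ?_, fun j hj => ?_⟩
    · rw [← hir] at hj; exact (mem_filter.1 hj).2
    · rw [mem_sdiff, ← hir, mem_filter] at hj
      exact (hpm i hi j (hs hj.1)).resolve_left fun h => hj.2 ⟨hj.1, h⟩)
  have hA₁ne : A₁.Nonempty := by
    rw [nonempty_iff_ne_empty]
    rintro rfl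
    simp at hA₁card
    exact hA.ne_empty hA₁card
  -- `σ` is the more frequent sign in the row `i₀`.
  obtain ⟨σ, hσ, hB₁⟩ : ∃ σ : ℝ, (σ = 1 ∨ σ = -1) ∧
      (#B : ℝ) ≤ 2 * #{j ∈ B | ⟪u i₀, w j⟫ = σ * g} := by
    have h1 : (#{j ∈ B | ⟪u i₀, w j⟫ = 1 * g} : ℝ) + #{j ∈ B | ⟪u i₀, w j⟫ = -1 * g} = #B := by
      have h2 : {j ∈ B | ⟪u i₀, w j⟫ = -1 * g} = {j ∈ B | ¬⟪u i₀, w j⟫ = 1 * g} := by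
        refine filter_congr fun j hj => ?_
        rcases hpm i₀ hi₀ j hj with h | h <;> rw [h] <;> constructor <;> intro h' <;> grind
      rw [h2]
      exact_mod_cast card_filter_add_card_filter_not (s := B) _
    rcases le_total (#{j ∈ B | ⟪u i₀, w j⟫ = -1 * g} : ℝ) #{j ∈ B | ⟪u i₀, w j⟫ = 1 * g}
      with h | h
    · exact ⟨1, Or.inl rfl, by linarith⟩
    · exact ⟨-1, Or.inr rfl, by linarith⟩
  have hσ2 : σ * σ = 1 := by rcases hσ with rfl | rfl <;> norm_num
  set B₁ := {j ∈ B | ⟪u i₀, w j⟫ = σ * g} with hB₁def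
  have hB₁B : B₁ ⊆ B := filter_subset _ _
  have hBpos : (0 : ℝ) < #B := by exact_mod_cast hB.card_pos
  -- In the columns `B₁`, the vectors `x i` record by `1` where row `i` differs from row `i₀`.
  set x : ι → V := fun i => (σ / (2 * g)) • (u i₀ - u i) with hx
  have hxw : ∀ i ∈ A, ∀ j ∈ B₁, (⟪u i, w j⟫ = σ * g ∧ ⟪x i, w j⟫ = 0) ∨
      (⟪u i, w j⟫ = -(σ * g) ∧ ⟪x i, w j⟫ = 1) := by
    intro i hi j hj
    have h1 : ⟪x i, w j⟫ = σ / (2 * g) * (σ * g - ⟪u i, w j⟫) := by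
      rw [hx, real_inner_smul_left, inner_sub_left, (mem_filter.1 hj).2]
    have h2 : ⟪u i, w j⟫ = σ * g ∨ ⟪u i, w j⟫ = -(σ * g) := by
      rcases hσ with rfl | rfl <;> rcases hpm i hi j (hB₁B hj) with h | h <;> simp [h]
    refine h2.imp (fun h => ⟨h, by rw [h1, h]; ring⟩) fun h => ⟨h, ?_⟩
    rw [h1, h]
    calc σ / (2 * g) * (σ * g - -(σ * g)) = σ * σ * (2 * g / (2 * g)) := by ring
      _ = 1 := by rw [hσ2, div_self (by positivity), one_mul]
  have hrow : ∀ i ∈ A₁, (#{j ∈ B₁ | ⟪x i, w j⟫ = 1} : ℝ) ≤ η ^ t / 2 * #B₁ := by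
    intro i hi
    have h1 : {j ∈ B₁ | ⟪x i, w j⟫ = 1} ⊆ {j ∈ B | ¬(⟪u i₀, w j⟫ = g ↔ ⟪u i, w j⟫ = g)} := by
      intro j hj
      obtain ⟨hj, hj1⟩ := mem_filter.1 hj
      refine mem_filter.2 ⟨hB₁B hj, ?_⟩
      have h2 := (mem_filter.1 hj).2
      rcases hxw i (hA₁ hi) j hj with h | h
      · rw [h.2] at hj1; norm_num at hj1
      · rw [h2, h.1]
        rcases hσ with rfl | rfl
        · simp [hgne.symm]
        · simp [hgne.symm]
    have h2 : (#{j ∈ B₁ | ⟪x i, w j⟫ = 1} : ℝ) ≤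
        #{j ∈ B | ¬(⟪u i₀, w j⟫ = g ↔ ⟪u i, w j⟫ = g)} := by exact_mod_cast card_le_card h1
    calc _ ≤ η ^ t / 4 * #B := h2.trans (hclose i hi)
      _ ≤ η ^ t / 4 * (2 * #B₁) := by gcongr
      _ = _ := by ring
  set B₂ := {j ∈ B₁ | (#{i ∈ A₁ | ⟪x i, w j⟫ = 1} : ℝ) ≤ 2 * (η ^ t / 2) * #A₁} with hB₂def
  have hB₂ : (#B₁ : ℝ) ≤ 2 * #B₂ :=
    card_le_two_mul_card_filter_sparse (fun i j => ⟪x i, w j⟫ = 1) A₁ B₁ (by positivity) hA₁ne hrow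
  have hB₂B₁ : B₂ ⊆ B₁ := filter_subset _ _
  have hxK : ∀ i ∈ A₁, ‖x i‖ ^ 2 ≤ K := by
    intro i hi
    have h1 : ‖u i₀ - u i‖ ≤ 2 := by
      linarith [norm_sub_le (u i₀) (u i), hu i₀ hi₀, hu i (hA₁ hi)]
    rw [hx, norm_smul, mul_pow, Real.norm_eq_abs, sq_abs]
    calc (σ / (2 * g)) ^ 2 * ‖u i₀ - u i‖ ^ 2 ≤ (σ / (2 * g)) ^ 2 * 2 ^ 2 := by gcongr
      _ = σ * σ * (1 / g ^ 2) := by field_simp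
      _ = 1 / g ^ 2 := by rw [hσ2, one_mul]
      _ ≤ 1 / γ ^ 2 := by gcongr
      _ ≤ K := by linarith
  have hwK : ∀ j ∈ B₂, ‖w j‖ ^ 2 ≤ K := fun j hj =>
    (pow_le_one₀ (norm_nonneg _) (hw j (hB₁B (hB₂B₁ hj)))).trans hK
  have hs : IsSparseBoolean K t (η ^ t) A₁ B₂ x w := by
    refine ⟨fun i hi j hj => ?_, hxK, hwK, fun i hi j hj => ?_, fun i hi => ?_, fun j hj => ?_⟩
    · exact (hxw i (hA₁ hi) j (hB₂B₁ hj)).imp And.right And.right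
    · linarith [hxK i hi, hwK j hj]
    · have h1 : (#{j ∈ B₂ | ⟪x i, w j⟫ = 1} : ℝ) ≤ #{j ∈ B₁ | ⟪x i, w j⟫ = 1} := by
        exact_mod_cast card_le_card (filter_subset_filter _ hB₂B₁)
      calc _ ≤ η ^ t / 2 * #B₁ := h1.trans (hrow i hi)
        _ ≤ η ^ t / 2 * (2 * #B₂) := by gcongr
        _ = _ := by ring
    · have h1 := (mem_filter.1 hj).2
      simp only [real_inner_comm] at h1 ⊢
      linarith
  obtain ⟨A', hA', B', hB', hA'c, hB'c, h0⟩ := hs.hasZeroRectangle hK hη hηK t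
  refine ⟨A', hA'.trans hA₁, B', hB'.trans (hB₂B₁.trans hB₁B), ?_, ?_, ?_⟩
  · have h1 : (#A : ℝ) ≤ m * #A₁ := by exact_mod_cast hA₁card
    calc η ^ t / (4 * m) * #A ≤ η ^ t / (4 * m) * (m * #A₁) := by gcongr
      _ = η ^ t * #A₁ / 4 := by field_simp
      _ ≤ η ^ t * #A₁ := div_le_self (by positivity) (by norm_num)
      _ ≤ _ := hA'c
  · calc η ^ t / (4 * m) * #B ≤ η ^ t / (4 * 1) * (4 * #B₂) := by gcongr; linarith
      _ = η ^ t * #B₂ := by ring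
      _ ≤ _ := hB'c
  · have h1 : ∀ i ∈ A', ∀ j ∈ B', ⟪u i, w j⟫ = σ * g := fun i hi j hj => by
      rcases hxw i (hA₁ (hA' hi)) j (hB₂B₁ (hB' hj)) with h | h
      · exact h.1
      · rw [h0 i hi j hj] at h; norm_num at h
    rcases hσ with rfl | rfl
    · exact Or.inl (by simpa using h1)
    · exact Or.inr (by simpa using h1)

/-! ### Lines through the origin -/

theorem mainTheorem11 (δ : ℝ) (hδ : 0 < δ) :
    ∃ c : ℝ, 0 < c ∧
      ∀ (V : Type*) [NormedAddCommGroup V] [InnerProductSpace ℝ V]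
        (α : ℝ), 0 ≤ α → α < Real.pi / 2 - δ →
      ∀ A B : Finset (ℙ ℝ V),
        (∀ ℓ₁ ∈ A, ∀ ℓ₂ ∈ B, lineAngle ℓ₁ ℓ₂ = α) →
      ∀ v : ℙ ℝ V → V, (∀ ℓ, ℓ ∈ A ∨ ℓ ∈ B → IsDirectionVector ℓ (v ℓ)) →
        ∃ A' B' : Finset (ℙ ℝ V), A' ⊆ A ∧ B' ⊆ B ∧
          c * (A.card : ℝ) ≤ (A'.card : ℝ) ∧ c * (B.card : ℝ) ≤ (B'.card : ℝ) ∧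
          ((∀ ℓ₁ ∈ A', ∀ ℓ₂ ∈ B', InnerProductGeometry.angle (v ℓ₁) (v ℓ₂) = α) ∨
            (∀ ℓ₁ ∈ A', ∀ ℓ₂ ∈ B',
              InnerProductGeometry.angle (v ℓ₁) (v ℓ₂) = Real.pi - α)) := by
  -- For `δ ≥ π / 2` no `α` is allowed.
  rcases le_or_gt (Real.pi / 2) δ with hδ' | hδ'
  · exact ⟨1, one_pos, fun V _ _ α h1 h2 => by linarith⟩
  have hsin : 0 < Real.sin δ := Real.sin_pos_of_pos_of_lt_pi hδ (by linarith [Real.pi_pos])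
  obtain ⟨c, hc0, hc1, hc⟩ := exists_constant_rectangle hsin
  refine ⟨c, hc0, fun V _ _ α hα0 hα A B hAB v hv => ?_⟩
  rcases A.eq_empty_or_nonempty with rfl | hA
  · exact ⟨∅, B, Subset.rfl, Subset.rfl, by simp,
      mul_le_of_le_one_left (by positivity) hc1, by simp⟩
  rcases B.eq_empty_or_nonempty with rfl | hB
  · exact ⟨A, ∅, Subset.rfl, Subset.rfl, mul_le_of_le_one_left (by positivity) hc1, by simp,
      by simp⟩
  have hg : Real.sin δ ≤ Real.cos α := by
    rw [← Real.cos_pi_div_two_sub]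
    exact Real.cos_le_cos_of_nonneg_of_le_pi hα0 (by linarith [Real.pi_pos]) hα.le
  set e : ℙ ℝ V → V := fun ℓ => (‖v ℓ‖⁻¹) • v ℓ with he
  have hnorm : ∀ ℓ, ‖e ℓ‖ ≤ 1 := fun ℓ => by
    rw [he, norm_smul, norm_inv, norm_norm]
    exact inv_mul_le_one
  have hcos : ∀ ℓ₁ ℓ₂, ⟪e ℓ₁, e ℓ₂⟫ = Real.cos (InnerProductGeometry.angle (v ℓ₁) (v ℓ₂)) := by
    intro ℓ₁ ℓ₂
    rw [InnerProductGeometry.cos_angle, he, real_inner_smul_left, real_inner_smul_right,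
      div_eq_mul_inv, mul_inv]
    ring
  obtain ⟨A', hA', B', hB', hA'c, hB'c, h⟩ := hc A B e e (Real.cos α) hg hA hB
    (fun ℓ _ => hnorm ℓ) (fun ℓ _ => hnorm ℓ) fun ℓ₁ h₁ ℓ₂ h₂ => by
      have h3 := hAB ℓ₁ h₁ ℓ₂ h₂
      rw [lineAngle_eq ℓ₁ ℓ₂ _ _ (hv ℓ₁ (Or.inl h₁)) (hv ℓ₂ (Or.inr h₂))] at h3
      rw [hcos]
      rcases min_choice (InnerProductGeometry.angle (v ℓ₁) (v ℓ₂))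
        (Real.pi - InnerProductGeometry.angle (v ℓ₁) (v ℓ₂)) with h4 | h4
      · left; rw [← h3, h4]
      · right; rw [← h3, h4, Real.cos_pi_sub, neg_neg]
  have hangle : ∀ ℓ₁ ℓ₂, ∀ θ : ℝ, 0 ≤ θ → θ ≤ Real.pi → ⟪e ℓ₁, e ℓ₂⟫ = Real.cos θ →
      InnerProductGeometry.angle (v ℓ₁) (v ℓ₂) = θ := fun ℓ₁ ℓ₂ θ h0 hπ h =>
    Real.injOn_cos ⟨InnerProductGeometry.angle_nonneg _ _, InnerProductGeometry.angle_le_pi _ _⟩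
      ⟨h0, hπ⟩ ((hcos ℓ₁ ℓ₂).symm.trans h)
  have hαπ : α ≤ Real.pi := by linarith [Real.pi_pos]
  refine ⟨A', B', hA', hB', hA'c, hB'c, h.imp (fun h ℓ₁ h₁ ℓ₂ h₂ => ?_) fun h ℓ₁ h₁ ℓ₂ h₂ => ?_⟩
  · exact hangle _ _ _ hα0 hαπ (h ℓ₁ h₁ ℓ₂ h₂)
  · exact hangle _ _ _ (by linarith) (by linarith) (by rw [Real.cos_pi_sub]; exact h ℓ₁ h₁ ℓ₂ h₂)
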